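/- Let $k$ be a commutative ring. Let $\Delta S_+$ be the category with objects $[n]=\{0,\dots,n\}$, $n\ge -1$ (so $[-1]=\emptyset$), in which a morphism $[n]\to[m]$ is a map of sets together with a total order on each of its fibres; the order on a fibre of a composite $gf$ compares two points first by their images under $f$ (in the fibre of $g$) and then, if these agree, in the fibre of $f$. Let $\Delta S$ be the full subcategory on the objects $[n]$ with $n\ge 0$. For an associative unital $k$-algebra $A$ let $B^{sym_+}_*A:\Delta S_+\to k\text{-}\mathbf{Mod}$ be the functor $[n]\mapsto A^{\otimes(n+1)}$ (so $[-1]\mapsto k$), where a morphism sends $a_0\otimes\cdots\otimes a_n$ to the tensor whose $j$-th factor is the product of the $a_i$ with $i$ in the fibre over $j$, taken in the order of that fibre (an empty product is $1_A$). Let $B^{sym}_*A$ be its restriction to $\Delta S$. The symmetric homology of $A$ is $HS_*(A)=\mathrm{Tor}^{\Delta S}_*(\underline{k},B^{sym}_*A)$, where $\underline{k}$ is the constant functor $\Delta S^{op}\to k\text{-}\mathbf{Mod}$ with value $k$ and, for a small category $\mathscr C$, $\mathrm{Tor}^{\mathscr C}_*$ denotes the left derived functors of the tensor product $M\otimes_{\mathscr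 C}N=\bigoplus_X M(X)\otimes_k N(X)/(f^*y\otimes x\sim y\otimes f_*x)$ of a contravariant and a covariant functor. Let $N(X\setminus\mathscr C)$ be the nerve of the category of objects under $X$, and put $$\mathscr Y_*A=k[N(-\setminus\Delta S)]\otimes_{\Delta S}B^{sym}_*A,\qquad \mathscr Y^+_*A=k[N(-\setminus\Delta S_+)]\otimes_{\Delta S_+}B^{sym_+}_*A,$$ chain complexes with differential the alternating sum of the face maps of the nerve. Let $J_A:\mathscr Y_*A\to\mathscr Y^+_*A$ be the chain map, natural in $A$, induced by the inclusion $\Delta S\subset\Delta S_+$. **Theorem.** (1) For every $n\ge 0$ there is an isomorphism of $k$-modules $HS_n(A)\cong H_n(\mathscr Y^+_*A)$, natural in the unital associative $k$-algebra $A$. (2) For every unital associative $k$-algebra $A$, the chain map $J_A:\mathscr Y_*A\to\mathscr Y^+_*A$ induces an isomorphism $H_*(\mathscr Y_*A)\to H_*(\mathscr Y^+_*A)$. -/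

import Mathlib

open CategoryTheory Opposite
open scoped TensorProduct

universe u

namespace SymmetricHomology

noncomputable section

section DeltaS

/-- The objects of `ΔS₊`.  The object `⟨n⟩` is the set with `n` elements `0, …, n - 1`, written
`[n - 1]` in the literature; in particular `⟨0⟩` is the empty set `[-1]`. -/
structure DeltaSPlus where
  card : ℕ

namespace DeltaSPlus

/-- A morphism `X ⟶ Y` of `ΔS₊` in tensor notation, such as `x₁x₀ ⊗ x₃x₄ ⊗ 1 ⊗ x₂`: a monomial
(list of variables) for every point `j` of `Y`, such that every variable `xᵢ`, with `i` in `X`,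
occurs exactly once in total.  This is the same as a map of sets `f : X → Y` (`f i` is the unique
`j` with `xᵢ` in `word j`) together with a total order on every fibre `f⁻¹(j)` (the order in which
the variables are listed in `word j`). -/
@[ext]
structure Hom (X Y : DeltaSPlus) where
  word : Fin Y.card → List (Fin X.card)
  count_eq_one : ∀ i, ∑ j, (word j).count i = 1

/-- Composition substitutes the monomials of the first morphism for the variables of the second
one. -/
instance : Category DeltaSPlus where
  Hom := Hom
  id X := ⟨fun i => [i], fun i => by simp [List.count_singleton]⟩
  comp f g := ⟨fun k => (g.word k).flatMap f.word, fun i => by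
    have h : ∀ k, ((g.word k).flatMap f.word).count i =
        ∑ j, (g.word k).count j * (f.word j).count i := fun k => by
      rw [List.count_flatMap]
      have := Finset.sum_list_map_count (g.word k) (fun j => (f.word j).count i)
      simp only [Function.comp_def]
      rw [this, Finset.sum_subset (Finset.subset_univ _)]
      · simp
      · intro j _ hj
        simp only [List.mem_toFinset] at hj
        simp [List.count_eq_zero_of_not_mem hj]
    simp only [h]
    rw [Finset.sum_comm]
    simp only [← Finset.sum_mul, g.count_eq_one, one_mul, f.count_eq_one]⟩
  id_comp f := by
    ext1; funext k; simp
  comp_id f := by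
    ext1; funext k; simp
  assoc f g h := by
    ext1; funext k; simp [List.flatMap_assoc]

@[simp]
lemma id_word (X : DeltaSPlus) (i : Fin X.card) : Hom.word (𝟙 X) i = [i] := rfl

@[simp]
lemma comp_word {X Y Z : DeltaSPlus} (f : X ⟶ Y) (g : Y ⟶ Z) (k : Fin Z.card) :
    Hom.word (f ≫ g) k = (Hom.word g k).flatMap (Hom.word f) := rfl

end DeltaSPlus

/-- The category `ΔS`: the full subcategory of `ΔS₊` on the non-empty sets `[n]`, `n ≥ 0`. -/
abbrev DeltaS := ObjectProperty.FullSubcategory (fun X : DeltaSPlus => 0 < X.card)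

/-- The inclusion `ΔS ⥤ ΔS₊`. -/
abbrev inclusion : DeltaS ⥤ DeltaSPlus := ObjectProperty.ι _

end DeltaS

section Bar

variable {k A : Type u} [CommRing k] [Ring A] [Algebra k A]

/-- Evaluation `α(a₀, …, aₙ)` of a morphism in tensor notation: substitute `aᵢ` for `xᵢ` and
multiply; the empty product is the unit of `A`. -/
def evalWord {X Y : DeltaSPlus} (α : X ⟶ Y) (a : Fin X.card → A) (j : Fin Y.card) : A :=
  ((DeltaSPlus.Hom.word α j).map a).prod

lemma evalWord_id (X : DeltaSPlus) (a : Fin X.card → A) : evalWord (𝟙 X) a = a := by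
  funext j; simp [evalWord]

lemma evalWord_comp {X Y Z : DeltaSPlus} (α : X ⟶ Y) (β : Y ⟶ Z) (a : Fin X.card → A) :
    evalWord (α ≫ β) a = evalWord β (evalWord α a) := by
  funext j
  simp only [evalWord, DeltaSPlus.comp_word]
  induction DeltaSPlus.Hom.word β j with
  | nil => simp
  | cons x l ih => simp [ih, evalWord]

lemma exists_evalWord_update {X Y : DeltaSPlus} (α : X ⟶ Y) (a : Fin X.card → A)
    (i : Fin X.card) : ∃ (j : Fin Y.card) (p q : A), ∀ x : A,
      evalWord α (Function.update a i x) = Function.update (evalWord α a) j (p * x * q) := by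
  have hmap : ∀ (l : List (Fin X.card)) (x : A), l.count i = 0 →
      l.map (Function.update a i x) = l.map a := fun l x hl => by
    refine List.map_congr_left fun b hb => Function.update_of_ne ?_ _ _
    rintro rfl
    exact List.count_eq_zero.mp hl hb
  have hsum := DeltaSPlus.Hom.count_eq_one α i
  obtain ⟨j, hj⟩ : ∃ j, (DeltaSPlus.Hom.word α j).count i ≠ 0 := by
    by_contra! h
    simp [h] at hsum
  rw [← Finset.add_sum_erase _ _ (Finset.mem_univ j)] at hsum
  have hj1 : (DeltaSPlus.Hom.word α j).count i = 1 := by omega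
  have hrest : ∀ j', j' ≠ j → (DeltaSPlus.Hom.word α j').count i = 0 := fun j' h => by
    have h0 : ∑ j' ∈ Finset.univ.erase j, (DeltaSPlus.Hom.word α j').count i = 0 := by omega
    exact Finset.sum_eq_zero_iff.mp h0 j' (by simp [h])
  have hmem : i ∈ DeltaSPlus.Hom.word α j := by
    by_contra h
    exact hj (List.count_eq_zero.mpr h)
  obtain ⟨s, t, hst⟩ := List.append_of_mem hmem
  rw [hst] at hj1
  simp only [List.count_append, List.count_cons_self] at hj1
  refine ⟨j, (s.map a).prod, (t.map a).prod, fun x => ?_⟩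
  funext j'
  by_cases h : j' = j
  · subst h
    simp [evalWord, hst, hmap s x (by omega), hmap t x (by omega), mul_assoc]
  · simp [evalWord, h, hmap _ x (hrest j' h)]

/-- The multilinear map underlying `B(α)`. -/
def barMultilinear (k A : Type u) [CommRing k] [Ring A] [Algebra k A] {X Y : DeltaSPlus}
    (α : X ⟶ Y) :
    MultilinearMap k (fun _ : Fin X.card => A) (PiTensorProduct k (fun _ : Fin Y.card => A)) where
  toFun a := PiTensorProduct.tprod k (evalWord α a)
  map_update_add' := by
    intro inst a i x y
    obtain rfl := Subsingleton.elim inst (instDecidableEqFin _)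
    obtain ⟨j, p, q, h⟩ := exists_evalWord_update α a i
    simp only [h, mul_add, add_mul, MultilinearMap.map_update_add]
  map_update_smul' := by
    intro inst a i c x
    obtain rfl := Subsingleton.elim inst (instDecidableEqFin _)
    obtain ⟨j, p, q, h⟩ := exists_evalWord_update α a i
    simp only [h, Algebra.mul_smul_comm, Algebra.smul_mul_assoc,
      MultilinearMap.map_update_smul]

/-- `B(α) : A^{⊗ X} → A^{⊗ Y}`, `a₀ ⊗ … ⊗ aₙ ↦ α(a₀, …, aₙ)`. -/
def barMap (k A : Type u) [CommRing k] [Ring A] [Algebra k A] {X Y : DeltaSPlus} (α : X ⟶ Y) :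
    PiTensorProduct k (fun _ : Fin X.card => A) →ₗ[k]
      PiTensorProduct k (fun _ : Fin Y.card => A) :=
  PiTensorProduct.lift (barMultilinear k A α)

@[simp]
lemma barMap_tprod {X Y : DeltaSPlus} (α : X ⟶ Y) (a : Fin X.card → A) :
    barMap k A α (PiTensorProduct.tprod k a) = PiTensorProduct.tprod k (evalWord α a) :=
  PiTensorProduct.lift.tprod a

variable (k)

/-- The functor `B^{sym₊} A : ΔS₊ ⥤ k-Mod`, natural in the `k`-algebra `A`.  It sends `[n]` to
`A^{⊗ (n + 1)}`; its value at `[-1]` is the empty tensor power, that is, `k`, and the unique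
morphism `[-1] ⟶ [n]` acts by `1 ↦ 1 ⊗ … ⊗ 1`. -/
def barPlus : AlgCat.{u} k ⥤ (DeltaSPlus ⥤ ModuleCat.{u} k) where
  obj A :=
    { obj := fun X => ModuleCat.of k (PiTensorProduct k (fun _ : Fin X.card => A))
      map := fun α => ModuleCat.ofHom (barMap k A α)
      map_id := fun X => by
        ext1
        exact PiTensorProduct.ext (MultilinearMap.ext fun a => by simp [evalWord_id])
      map_comp := fun α β => by
        ext1
        exact PiTensorProduct.ext (MultilinearMap.ext fun a => by simp [evalWord_comp]) }
  map {A B} f :=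
    { app := fun X => ModuleCat.ofHom (PiTensorProduct.map fun _ => f.hom.toLinearMap)
      naturality := fun X Y α => by
        ext1
        refine PiTensorProduct.ext (MultilinearMap.ext fun a => ?_)
        simp only [ModuleCat.hom_comp, ModuleCat.hom_ofHom, LinearMap.compMultilinearMap_apply,
          LinearMap.comp_apply, PiTensorProduct.map_tprod, barMap_tprod]
        congr 1
        funext j
        simp only [evalWord, AlgHom.toLinearMap_apply, map_list_prod, List.map_map,
          Function.comp_def] }
  map_id A := by
    ext X : 3
    exact PiTensorProduct.ext (MultilinearMap.ext fun a => by simp)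
  map_comp f g := by
    ext X : 3
    exact PiTensorProduct.ext (MultilinearMap.ext fun a => by simp)

/-- The symmetric bar construction `B^{sym} A : ΔS ⥤ k-Mod`, natural in `A`. -/
def bar : AlgCat.{u} k ⥤ (DeltaS ⥤ ModuleCat.{u} k) :=
  barPlus k ⋙ (Functor.whiskeringLeft _ _ _).obj inclusion

end Bar

section CategoricalTensor

variable {k : Type u} [CommRing k] {C : Type} [SmallCategory C] {D : Type} [SmallCategory D]

open Classical in
/-- The relations `f^*(y) ⊗ x ≈ y ⊗ f_*(x)`. -/
def tensorRel (M : Cᵒᵖ ⥤ ModuleCat.{u} k) (N : C ⥤ ModuleCat.{u} k) :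
    Submodule k (DirectSum C fun X => M.obj (op X) ⊗[k] N.obj X) :=
  Submodule.span k {z | ∃ (X Y : C) (f : X ⟶ Y) (y : M.obj (op Y)) (x : N.obj X),
    z = DirectSum.lof k C (fun X => M.obj (op X) ⊗[k] N.obj X) Y (y ⊗ₜ N.map f x) -
      DirectSum.lof k C (fun X => M.obj (op X) ⊗[k] N.obj X) X (M.map f.op y ⊗ₜ x)}

/-- The categorical tensor product `M ⊗_C N` of a `Cᵒᵖ`-module and a `C`-module. -/
abbrev CTensor (M : Cᵒᵖ ⥤ ModuleCat.{u} k) (N : C ⥤ ModuleCat.{u} k) : Type u :=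
  (DirectSum C fun X => M.obj (op X) ⊗[k] N.obj X) ⧸ tensorRel M N

namespace CTensor

open Classical in
/-- The canonical map `M(X) ⊗ N(X) → M ⊗_C N`. -/
def incl (M : Cᵒᵖ ⥤ ModuleCat.{u} k) (N : C ⥤ ModuleCat.{u} k) (X : C) :
    M.obj (op X) ⊗[k] N.obj X →ₗ[k] CTensor M N :=
  (tensorRel M N).mkQ ∘ₗ DirectSum.lof k C (fun X => M.obj (op X) ⊗[k] N.obj X) X

lemma incl_rel {M : Cᵒᵖ ⥤ ModuleCat.{u} k} {N : C ⥤ ModuleCat.{u} k} {X Y : C} (f : X ⟶ Y)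
    (y : M.obj (op Y)) (x : N.obj X) :
    incl M N Y (y ⊗ₜ N.map f x) = incl M N X (M.map f.op y ⊗ₜ x) :=
  (Submodule.Quotient.eq _).mpr (Submodule.subset_span ⟨X, Y, f, y, x, rfl⟩)

open Classical in
lemma hom_ext {M : Cᵒᵖ ⥤ ModuleCat.{u} k} {N : C ⥤ ModuleCat.{u} k} {P : Type*}
    [AddCommGroup P] [Module k P] {f g : CTensor M N →ₗ[k] P}
    (h : ∀ (X : C) (y : M.obj (op X)) (x : N.obj X),
      f (incl M N X (y ⊗ₜ x)) = g (incl M N X (y ⊗ₜ x))) : f = g := by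
  refine Submodule.linearMap_qext _ (DirectSum.linearMap_ext _ fun X => ?_)
  exact TensorProduct.ext' fun y x => h X y x

open Classical in
/-- The universal property of `M ⊗_C N`. -/
def desc {M : Cᵒᵖ ⥤ ModuleCat.{u} k} {N : C ⥤ ModuleCat.{u} k} {P : Type*}
    [AddCommGroup P] [Module k P] (φ : ∀ X : C, M.obj (op X) ⊗[k] N.obj X →ₗ[k] P)
    (hφ : ∀ (X Y : C) (f : X ⟶ Y) (y : M.obj (op Y)) (x : N.obj X),
      φ Y (y ⊗ₜ N.map f x) = φ X (M.map f.op y ⊗ₜ x)) : CTensor M N →ₗ[k] P :=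
  (tensorRel M N).liftQ (DirectSum.toModule k C P φ) (by
    rw [tensorRel, Submodule.span_le]
    rintro _ ⟨X, Y, f, y, x, rfl⟩
    simp [hφ X Y f y x])

@[simp]
lemma desc_incl {M : Cᵒᵖ ⥤ ModuleCat.{u} k} {N : C ⥤ ModuleCat.{u} k} {P : Type*}
    [AddCommGroup P] [Module k P] (φ : ∀ X : C, M.obj (op X) ⊗[k] N.obj X →ₗ[k] P)
    (hφ : ∀ (X Y : C) (f : X ⟶ Y) (y : M.obj (op Y)) (x : N.obj X),
      φ Y (y ⊗ₜ N.map f x) = φ X (M.map f.op y ⊗ₜ x)) (X : C)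
    (z : M.obj (op X) ⊗[k] N.obj X) : desc φ hφ (incl M N X z) = φ X z := by
  simp [desc, incl]

/-- The map `M ⊗_C N → M' ⊗_C N'` induced by `σ : M ⟶ M'` and `τ : N ⟶ N'`. -/
def map {M M' : Cᵒᵖ ⥤ ModuleCat.{u} k} {N N' : C ⥤ ModuleCat.{u} k} (σ : M ⟶ M') (τ : N ⟶ N') :
    CTensor M N →ₗ[k] CTensor M' N' :=
  desc (fun X => incl M' N' X ∘ₗ TensorProduct.map (σ.app (op X)).hom (τ.app X).hom)
    (fun X Y f y x => by
      have h1 := NatTrans.naturality_apply τ f x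
      have h2 := NatTrans.naturality_apply σ f.op y
      simp only [LinearMap.comp_apply, TensorProduct.map_tmul]
      erw [h1, h2]
      exact incl_rel f _ _)

@[simp]
lemma map_incl {M M' : Cᵒᵖ ⥤ ModuleCat.{u} k} {N N' : C ⥤ ModuleCat.{u} k} (σ : M ⟶ M')
    (τ : N ⟶ N') (X : C) (y : M.obj (op X)) (x : N.obj X) :
    map σ τ (incl M N X (y ⊗ₜ x)) = incl M' N' X (σ.app (op X) y ⊗ₜ τ.app X x) := by
  simp [map]

/-- For a functor `i : C ⥤ D`, the passage `M ⊗_C N → M ⊗_D N` from tensors over `C` to tensors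
over `D`, where the `D`-modules on the left are restricted to `C` along `i`. -/
def change (i : C ⥤ D) (M : Dᵒᵖ ⥤ ModuleCat.{u} k) (N : D ⥤ ModuleCat.{u} k) :
    CTensor (i.op ⋙ M) (i ⋙ N) →ₗ[k] CTensor M N :=
  desc (fun X => incl M N (i.obj X)) (fun _ _ f y x => incl_rel (i.map f) y x)

@[simp]
lemma change_incl (i : C ⥤ D) (M : Dᵒᵖ ⥤ ModuleCat.{u} k) (N : D ⥤ ModuleCat.{u} k) (X : C)
    (z : M.obj (op (i.obj X)) ⊗[k] N.obj (i.obj X)) :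
    change i M N (incl (i.op ⋙ M) (i ⋙ N) X z) = incl M N (i.obj X) z :=
  desc_incl _ _ _ _

lemma change_comp_map (i : C ⥤ D) {M M' : Dᵒᵖ ⥤ ModuleCat.{u} k} {N N' : D ⥤ ModuleCat.{u} k}
    (σ : M ⟶ M') (τ : N ⟶ N') :
    map σ τ ∘ₗ change i M N = change i M' N' ∘ₗ
      map (Functor.whiskerLeft i.op σ) (Functor.whiskerLeft i τ) :=
  hom_ext fun X y x => by
    have h1 := change_incl i M N X (y ⊗ₜ x)
    have h2 := change_incl i M' N' X (σ.app (op (i.obj X)) y ⊗ₜ τ.app (i.obj X) x)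
    rw [LinearMap.comp_apply, LinearMap.comp_apply, h1, map_incl, map_incl]
    exact h2.symm

lemma map_comp_map {M M' M'' : Cᵒᵖ ⥤ ModuleCat.{u} k} {N N' N'' : C ⥤ ModuleCat.{u} k}
    (σ : M ⟶ M') (σ' : M' ⟶ M'') (τ : N ⟶ N') (τ' : N' ⟶ N'') :
    map σ' τ' ∘ₗ map σ τ = map (σ ≫ σ') (τ ≫ τ') :=
  hom_ext fun X y x => by simp

end CTensor

/-- The functor `M ↦ M ⊗_C N` from `Cᵒᵖ`-modules to `k`-modules, natural in `N`. -/
def tensorFunctor (k : Type u) [CommRing k] (C : Type) [SmallCategory C] :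
    (C ⥤ ModuleCat.{u} k) ⥤ (Cᵒᵖ ⥤ ModuleCat.{u} k) ⥤ ModuleCat.{u} k where
  obj N :=
    { obj := fun M => ModuleCat.of k (CTensor M N)
      map := fun σ => ModuleCat.ofHom (CTensor.map σ (𝟙 N))
      map_id := fun M => by
        ext1
        exact CTensor.hom_ext fun X y x => by simp
      map_comp := fun σ τ => by
        ext1
        exact CTensor.hom_ext fun X y x => by simp }
  map {N N'} τ :=
    { app := fun M => ModuleCat.ofHom (CTensor.map (𝟙 M) τ)
      naturality := fun M M' σ => by
        ext1
        exact CTensor.hom_ext fun X y x => by simp }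
  map_id N := by
    ext M : 3
    exact CTensor.hom_ext fun X y x => by simp
  map_comp τ τ' := by
    ext M : 3
    exact CTensor.hom_ext fun X y x => by simp

instance (N : C ⥤ ModuleCat.{u} k) : ((tensorFunctor k C).obj N).Additive where
  map_add {M M'} σ τ := by
    ext1
    have h : CTensor.map (σ + τ) (𝟙 N) = CTensor.map σ (𝟙 N) + CTensor.map τ (𝟙 N) :=
      CTensor.hom_ext fun X y x => by simp [TensorProduct.add_tmul]
    exact h

end CategoricalTensor

section Tor

variable (k : Type u) [CommRing k] (C : Type) [SmallCategory C]

/-- The category of functors from a small category to `k`-modules has enough projectives. -/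
instance : EnoughProjectives (C ⥤ ModuleCat.{u} k) where
  presentation F := by
    have hadj : ∀ c : C, (evaluationLeftAdjoint (ModuleCat.{u} k) c).PreservesProjectiveObjects :=
      fun c => Functor.preservesProjectiveObjects_of_adjunction_of_preservesEpimorphisms
        (evaluationAdjunctionRight (ModuleCat.{u} k) c)
    have hp : ∀ c : C, Projective ((evaluationLeftAdjoint (ModuleCat.{u} k) c).obj
        (Projective.over (F.obj c))) := fun c =>
      Functor.projective_obj_of_projective _ inferInstance
    let g : ∀ c : C, (evaluationLeftAdjoint (ModuleCat.{u} k) c).obj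
        (Projective.over (F.obj c)) ⟶ F := fun c =>
      ((evaluationAdjunctionRight (ModuleCat.{u} k) c).homEquiv _ _).symm
        (Projective.π (F.obj c))
    have hg : ∀ c : C, (evaluationAdjunctionRight (ModuleCat.{u} k) c).unit.app _ ≫
        (g c).app c = Projective.π (F.obj c) := fun c => by
      have := ((evaluationAdjunctionRight (ModuleCat.{u} k) c).homEquiv _ _).apply_symm_apply
        (Projective.π (F.obj c))
      rw [Adjunction.homEquiv_unit] at this
      exact this
    let P : C → (C ⥤ ModuleCat.{u} k) := fun c =>
      (evaluationLeftAdjoint (ModuleCat.{u} k) c).obj (Projective.over (F.obj c))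
    have hP : Projective (∐ P) :=
      ⟨fun f e _ => ⟨Limits.Sigma.desc fun c => (hp c).factors (Limits.Sigma.ι P c ≫ f) e |>.choose,
        Limits.Sigma.hom_ext _ _ fun c => by
          rw [Limits.Sigma.ι_desc_assoc]
          exact ((hp c).factors (Limits.Sigma.ι P c ≫ f) e).choose_spec⟩⟩
    have hepi : Epi (Limits.Sigma.desc g : ∐ P ⟶ F) := by
      rw [NatTrans.epi_iff_epi_app]
      intro c
      refine epi_of_epi_fac (f := (evaluationAdjunctionRight (ModuleCat.{u} k) c).unit.app _ ≫
        (Limits.Sigma.ι P c).app c) (h := Projective.π (F.obj c)) ?_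
      rw [Category.assoc, ← NatTrans.comp_app, Limits.Sigma.ι_desc]
      exact hg c
    exact ⟨{ p := ∐ P, projective := hP, f := Limits.Sigma.desc g, epi := hepi }⟩

/-- `Tor_n^C(M, -)` for a `Cᵒᵖ`-module `M`: the value at `M` of the `n`-th left derived functor
of `- ⊗_C N`, as a functor of the `C`-module `N`. -/
def tor (n : ℕ) (M : Cᵒᵖ ⥤ ModuleCat.{u} k) : (C ⥤ ModuleCat.{u} k) ⥤ ModuleCat.{u} k where
  obj N := (((tensorFunctor k C).obj N).leftDerived n).obj M
  map τ := (NatTrans.leftDerived ((tensorFunctor k C).map τ) n).app M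
  map_id N := by simp
  map_comp τ τ' := by simp

/-- The trivial `Cᵒᵖ`-module: the constant functor with value `k`. -/
def trivialModule : Cᵒᵖ ⥤ ModuleCat.{u} k := (Functor.const _).obj (ModuleCat.of k k)

/-- Symmetric homology `HS_n(A) = Tor_n^{ΔS}(k, B^{sym} A)`, as a functor of the algebra `A`. -/
def HS (n : ℕ) : AlgCat.{u} k ⥤ ModuleCat.{u} k :=
  bar k ⋙ tor k DeltaS n (trivialModule k DeltaS)

end Tor

section StandardComplex

variable (k : Type u) [CommRing k]

/-- The free `k`-module on a set. -/
def freeModule : Type ⥤ ModuleCat.{u} k where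
  obj S := ModuleCat.of k (S →₀ k)
  map f := ModuleCat.ofHom (Finsupp.lmapDomain k k f)
  map_id S := by
    ext1
    exact Finsupp.lmapDomain_id k k
  map_comp f g := by
    ext1
    exact Finsupp.lmapDomain_comp k k f g

/-- The simplicial `Cᵒᵖ`-set `N(- \ C)`, which sends `X` to the nerve of the category of objects
under `X`. -/
def underNerve (C : Type) [SmallCategory C] : Cᵒᵖ ⥤ SSet.{0} :=
  Under.mapFunctor C ⋙ nerveFunctor

/-- The simplicial `Cᵒᵖ`-module `k[N(- \ C)]`. -/
def underNerveModule (C : Type) [SmallCategory C] : SimplicialObject (Cᵒᵖ ⥤ ModuleCat.{u} k) :=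
  (underNerve C).flip ⋙ (Functor.whiskeringRight _ _ _).obj (freeModule k)

lemma under_map_comp_post {C D : Type} [SmallCategory C] [SmallCategory D] (i : C ⥤ D)
    {X Y : C} (f : X ⟶ Y) :
    Under.map f ⋙ Under.post i = Under.post i ⋙ Under.map (i.map f) := by
  have hobj : ∀ U : Under Y, (Under.map f ⋙ Under.post i).obj U =
      (Under.post i ⋙ Under.map (i.map f)).obj U := fun U =>
    congrArg (Under.mk (Y := i.obj U.right)) (i.map_comp f U.hom)
  refine CategoryTheory.Functor.ext hobj fun U V φ => ?_
  ext
  have h1 : Under.Hom.right (eqToHom (hobj U)) = 𝟙 (i.obj U.right) :=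
    Under.eqToHom_right (hobj U)
  have h2 : Under.Hom.right (eqToHom (hobj V).symm) = 𝟙 (i.obj V.right) :=
    Under.eqToHom_right (hobj V).symm
  rw [Under.comp_right, Under.comp_right, h1, h2]
  exact ((Category.id_comp _).trans (Category.comp_id _)).symm

/-- The map `N(- \ C) ⟶ N(- \ D)` induced by a functor `i : C ⥤ D`. -/
def underNerveMap {C D : Type} [SmallCategory C] [SmallCategory D] (i : C ⥤ D) :
    underNerve C ⟶ i.op ⋙ underNerve D where
  app _ := nerveMap (Under.post i)
  naturality _ _ f :=
    congrArg (fun F => nerveMap F) (under_map_comp_post i f.unop)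

/-- The map `k[N(- \ C)] ⟶ k[N(- \ D)]` of simplicial `Cᵒᵖ`-modules. -/
def underNerveModuleMap {C D : Type} [SmallCategory C] [SmallCategory D] (i : C ⥤ D) :
    underNerveModule k C ⟶
      underNerveModule k D ⋙ (Functor.whiskeringLeft _ _ _).obj i.op :=
  Functor.whiskerRight ((flipFunctor _ _ _).map (underNerveMap i))
    ((Functor.whiskeringRight _ _ _).obj (freeModule k))

/-- The simplicial `k`-module `k[N(- \ C)] ⊗_C N`, natural in the `C`-module `N`. -/
def simplicialTensor (C : Type) [SmallCategory C] :
    (C ⥤ ModuleCat.{u} k) ⥤ SimplicialObject (ModuleCat.{u} k) :=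
  tensorFunctor k C ⋙ (Functor.whiskeringLeft _ _ _).obj (underNerveModule k C)

/-- The chain complex `k[N(- \ C)] ⊗_C N`, with differential the alternating sum of the faces. -/
def standardComplex (C : Type) [SmallCategory C] :
    (C ⥤ ModuleCat.{u} k) ⥤ ChainComplex (ModuleCat.{u} k) ℕ :=
  simplicialTensor k C ⋙ AlgebraicTopology.alternatingFaceMapComplex _

/-- For a functor `i : C ⥤ D`, the map
`k[N(- \ C)] ⊗_C N ⟶ k[N(- \ D)] ⊗_C N ⟶ k[N(- \ D)] ⊗_D N`, natural in the `D`-module `N`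
(which is restricted to `C` in the first two terms).  Both arrows are induced by `i`. -/
def simplicialTensorMap {C D : Type} [SmallCategory C] [SmallCategory D] (i : C ⥤ D) :
    (Functor.whiskeringLeft _ _ _).obj i ⋙ simplicialTensor k C ⟶ simplicialTensor k D where
  app N :=
    { app := fun Δ =>
        ((tensorFunctor k C).obj (i ⋙ N)).map ((underNerveModuleMap k i).app Δ) ≫
          ModuleCat.ofHom (CTensor.change i ((underNerveModule k D).obj Δ) N)
      naturality := fun Δ Δ' δ => by
        have h1 := CTensor.change_comp_map i ((underNerveModule k D).map δ) (𝟙 N)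
        have h2 := (underNerveModuleMap k i).naturality δ
        ext1
        change CTensor.change i _ N ∘ₗ CTensor.map _ _ ∘ₗ CTensor.map _ _ =
          CTensor.map _ _ ∘ₗ CTensor.change i _ N ∘ₗ CTensor.map _ _
        rw [← LinearMap.comp_assoc (CTensor.map _ _) (CTensor.change i _ N), h1,
          LinearMap.comp_assoc, CTensor.map_comp_map, CTensor.map_comp_map]
        congr 2 }
  naturality N N' τ := by
    apply NatTrans.ext
    funext Δ
    ext1
    have h1 := CTensor.change_comp_map i (𝟙 ((underNerveModule k D).obj Δ)) τ
    change CTensor.change i _ N' ∘ₗ CTensor.map _ _ ∘ₗ CTensor.map _ _ =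
      CTensor.map _ _ ∘ₗ CTensor.change i _ N ∘ₗ CTensor.map _ _
    rw [← LinearMap.comp_assoc (CTensor.map _ _) (CTensor.change i _ N), h1,
      LinearMap.comp_assoc, CTensor.map_comp_map, CTensor.map_comp_map]
    congr 2

/-- The complex `Y_* A = k[N(- \ ΔS)] ⊗_{ΔS} B^{sym} A`. -/
def YComplex : AlgCat.{u} k ⥤ ChainComplex (ModuleCat.{u} k) ℕ :=
  bar k ⋙ standardComplex k DeltaS

/-- The complex `Y⁺_* A = k[N(- \ ΔS₊)] ⊗_{ΔS₊} B^{sym₊} A`. -/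
def YPlusComplex : AlgCat.{u} k ⥤ ChainComplex (ModuleCat.{u} k) ℕ :=
  barPlus k ⋙ standardComplex k DeltaSPlus

/-- The natural chain map `J_A : Y_* A ⟶ Y⁺_* A` induced by the inclusion of `ΔS` in `ΔS₊`. -/
def J : YComplex k ⟶ YPlusComplex k :=
  Functor.whiskerLeft (barPlus k)
    (Functor.whiskerRight (simplicialTensorMap k inclusion)
      (AlgebraicTopology.alternatingFaceMapComplex _))

end StandardComplex

end

end SymmetricHomology

/-! For any small `C`, the complex `k[N(- \ C)]` is a projective resolution of the trivial
`Cᵒᵖ`-module. It is acyclic over `k` at each `X` because `X \ C` has the initial object `𝟙 X`, which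
gives an extra degeneracy (`extraDegeneracy`). It is projective in each degree because an
`n`-simplex of `N(X \ C)` is a string `c₀ → … → cₙ` in `C` with an arrow `X → c₀`, so the module is
a sum of linearised representables. Hence `Tor^C(k, N)` is the homology of `k[N(- \ C)] ⊗_C N`,
naturally in `N` (`torIsoHomology`).

To compare `ΔS` with `ΔS₊`, let `F[n] = [0] ⊔ [n]`, a functor `ΔS₊ ⥤ ΔS`, with the natural inclusion
`η : [n] ⟶ F[n]`. The map `σ ⊗ x ↦ Fσ ⊗ η_* x` is a homotopy inverse of `J_A`. Indeed, moving `η`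
across the tensor sign turns both composites into the map that extends each arrow `X ⟶ Y` to `X ⟶ Y
⟶ F Y`. This map is an endomorphism of the resolution over the identity, so it is homotopic to the
identity, and stays so after tensoring (`tensorTranslateHomotopy`). Part (1) follows by composing
the isomorphism for `ΔS` with `J`. -/

namespace SymmetricHomology

noncomputable section

/-! ### Extra degeneracy on the nerve of a category with an initial object -/

section ExtraDegeneracy

variable {E : Type} [SmallCategory E] {I : E} (hI : Limits.IsInitial I)

/-- Prepend an initial object to a string of composable arrows. -/
def prependInitial {n : ℕ} (F : ComposableArrows E n) : ComposableArrows E (n + 1) :=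
  F.precomp (hI.to F.left)

/-- A string is determined by its first object, its first arrow and its tail, and an arrow out of an
initial object involves no choice. Covers faces and degeneracies at once. -/
lemma comp_prependInitial {m n : ℕ} (K : Fin (m + 1) ⥤ Fin (n + 1)) (K' : Fin (m + 2) ⥤ Fin (n + 2))
    (h₀ : K'.obj 0 = 0) (h : ∀ x, K'.obj x.succ = (K.obj x).succ) (F : ComposableArrows E n) :
    (K' ⋙ prependInitial hI F : ComposableArrows E (m + 1)) = prependInitial hI (K ⋙ F) := by
  have h₀' : (prependInitial hI F).obj (K'.obj 0) = I :=
    congrArg (prependInitial hI F).obj h₀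
  -- The first object equals `I` only through `h₀'`, so its initiality is transported.
  refine ComposableArrows.ext_succ h₀' ?_ ((hI.ofIso (eqToIso h₀'.symm)).hom_ext _ _)
  have hK : Fin.succFunctor (m + 1) ⋙ K' = K ⋙ Fin.succFunctor (n + 1) :=
    CategoryTheory.Functor.ext h fun _ _ _ => Subsingleton.elim _ _
  exact congrArg (· ⋙ prependInitial hI F) hK

lemma δ_succ_prependInitial {n : ℕ} (i : Fin (n + 2)) (F : ComposableArrows E (n + 1)) :
    (nerve E).δ i.succ (prependInitial hI F) = prependInitial hI ((nerve E).δ i F) :=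
  comp_prependInitial hI (SimplexCategory.toCat.map (SimplexCategory.δ i)).toFunctor
    (SimplexCategory.toCat.map (SimplexCategory.δ i.succ)).toFunctor
    (Fin.succ_succAbove_zero i) (fun x => Fin.succ_succAbove_succ i x) F

lemma σ_succ_prependInitial {n : ℕ} (i : Fin (n + 1)) (F : ComposableArrows E n) :
    (nerve E).σ i.succ (prependInitial hI F) = prependInitial hI ((nerve E).σ i F) :=
  comp_prependInitial hI (SimplexCategory.toCat.map (SimplexCategory.σ i)).toFunctor
    (SimplexCategory.toCat.map (SimplexCategory.σ i.succ)).toFunctor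
    rfl (fun x => Fin.succ_predAbove_succ i x) F

lemma δ_one_prependInitial (F : ComposableArrows E 0) :
    (nerve E).δ 1 (prependInitial hI F) = ComposableArrows.mk₀ I :=
  ComposableArrows.ext₀ rfl

end ExtraDegeneracy

/-! ### The augmented simplicial module `k[N(- \ C)] ⟶ k` -/

section Augmentation

variable (k : Type u) [CommRing k] (C : Type) [SmallCategory C]

variable {C} in
/-- The basis element of `k[N_n(X \ C)]` given by a simplex. -/
def basisSimplex {Δ : SimplexCategoryᵒᵖ} {X : Cᵒᵖ}
    (σ : ComposableArrows (Under X.unop) Δ.unop.len) : ((underNerveModule k C).obj Δ).obj X :=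
  Finsupp.single σ (1 : k)

variable {k C} in
/-- The linear map on `k[N_n(X \ C)]` with prescribed values on simplices. -/
def basisLift {Δ : SimplexCategoryᵒᵖ} {X : Cᵒᵖ} {M : Type*} [AddCommGroup M] [Module k M]
    (φ : ComposableArrows (Under X.unop) Δ.unop.len → M) :
    ((underNerveModule k C).obj Δ).obj X →ₗ[k] M :=
  Finsupp.linearCombination k φ

variable {k C} in
@[simp]
lemma basisLift_basisSimplex {Δ : SimplexCategoryᵒᵖ} {X : Cᵒᵖ} {M : Type*} [AddCommGroup M]
    [Module k M] (φ : ComposableArrows (Under X.unop) Δ.unop.len → M)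
    (σ : ComposableArrows (Under X.unop) Δ.unop.len) : basisLift φ (basisSimplex k σ) = φ σ :=
  (Finsupp.linearCombination_single k _ _).trans (one_smul k _)

variable {k C} in
lemma basis_ext {Δ : SimplexCategoryᵒᵖ} {X : Cᵒᵖ} {M : Type*} [AddCommGroup M] [Module k M]
    {f g : ((underNerveModule k C).obj Δ).obj X →ₗ[k] M}
    (h : ∀ σ, f (basisSimplex k σ) = g (basisSimplex k σ)) : f = g :=
  Finsupp.lhom_ext' fun σ => LinearMap.ext_ring (h σ)

@[simp]
lemma underNerveModule_obj_map_basisSimplex {Δ : SimplexCategoryᵒᵖ} {X Y : Cᵒᵖ} (f : X ⟶ Y)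
    (σ : ComposableArrows (Under X.unop) Δ.unop.len) :
    ((underNerveModule k C).obj Δ).map f (basisSimplex k σ) =
      basisSimplex k (σ ⋙ Under.map f.unop) :=
  Finsupp.mapDomain_single

@[simp]
lemma underNerveModule_map_app_basisSimplex {Δ Δ' : SimplexCategoryᵒᵖ} (δ : Δ ⟶ Δ') {X : Cᵒᵖ}
    (σ : ComposableArrows (Under X.unop) Δ.unop.len) :
    ((underNerveModule k C).map δ).app X (basisSimplex k σ) =
      basisSimplex k (σ.whiskerLeft (SimplexCategory.toCat.map δ.unop).toFunctor) :=
  Finsupp.mapDomain_single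

/-- The simplicial `Cᵒᵖ`-module `k[N(- \ C)]` with its augmentation to the trivial module. -/
def augmentedUnderNerveModule : SimplicialObject.Augmented (Cᵒᵖ ⥤ ModuleCat.{u} k) where
  left := underNerveModule k C
  right := trivialModule k C
  hom :=
    { app := fun Δ =>
        { app := fun X => ModuleCat.ofHom (basisLift fun _ => (1 : k))
          naturality := fun X Y f => by
            ext1
            refine basis_ext fun σ => ?_
            exact (congrArg (basisLift (M := k) fun _ => 1)
              (underNerveModule_obj_map_basisSimplex k C f σ)).trans
              ((basisLift_basisSimplex (M := k) _ _).trans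
                (basisLift_basisSimplex (M := k) (fun _ => 1) σ).symm) }
      naturality := fun Δ Δ' δ => by
        ext X : 3
        refine basis_ext fun σ => ?_
        exact (congrArg (basisLift (M := k) fun _ => 1)
          (underNerveModule_map_app_basisSimplex k C δ σ)).trans
          ((basisLift_basisSimplex (M := k) _ _).trans
            (basisLift_basisSimplex (M := k) (fun _ => 1) σ).symm) }

variable {C} in
/-- The augmented simplicial `k`-module `k[N(X \ C)] ⟶ k` has an extra degeneracy. -/
def extraDegeneracy (X : Cᵒᵖ) :
    (((SimplicialObject.Augmented.whiskering _ _).obj ((evaluation _ _).obj X)).obj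
      (augmentedUnderNerveModule k C)).ExtraDegeneracy where
  s' := ModuleCat.ofHom (Finsupp.lsingle (M := k) (R := k)
    (ComposableArrows.mk₀ (Under.mk (𝟙 X.unop))))
  s n := (freeModule k).map (TypeCat.ofHom (prependInitial (Under.mkIdInitial (X := X.unop)) (n := n)))
  s'_comp_ε := by
    ext1
    refine LinearMap.ext fun r => ?_
    exact (Finsupp.linearCombination_single k r _).trans (mul_one (M := k) r)
  s₀_comp_δ₁ := by
    ext1
    refine Finsupp.lhom_ext fun σ r => ?_
    change Finsupp.mapDomain _ (Finsupp.mapDomain _ (Finsupp.single σ r)) =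
      Finsupp.single _ (Finsupp.linearCombination k (fun _ => (1 : k)) (Finsupp.single σ r))
    rw [Finsupp.mapDomain_single, Finsupp.mapDomain_single, Finsupp.linearCombination_single,
      smul_eq_mul, mul_one]
    congr 1
    exact δ_one_prependInitial _ σ
  s_comp_δ₀ n := by
    -- Deleting the prepended vertex returns the original string definitionally.
    exact ((freeModule k).map_comp _ _).symm.trans ((freeModule k).map_id _)
  s_comp_δ n i := by
    refine ((freeModule k).map_comp _ _).symm.trans (Eq.trans ?_ ((freeModule k).map_comp _ _))
    congr 1
    ext F
    exact δ_succ_prependInitial _ i F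
  s_comp_σ n i := by
    refine ((freeModule k).map_comp _ _).symm.trans (Eq.trans ?_ ((freeModule k).map_comp _ _))
    congr 1
    ext F
    exact σ_succ_prependInitial _ i F

end Augmentation

/-! ### Additive functors and alternating face map complexes -/

section AlternatingFaceMapComplex

open AlgebraicTopology

variable {V W : Type*} [Category V] [Category W] [Preadditive V] [Preadditive W]

/-- An additive functor commutes with the formation of alternating face map complexes. -/
def mapAlternatingFaceMapComplexIso (F : V ⥤ W) [F.Additive] :
    alternatingFaceMapComplex V ⋙ F.mapHomologicalComplex _ ≅
      (SimplicialObject.whiskering V W).obj F ⋙ alternatingFaceMapComplex W :=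
  eqToIso (map_alternatingFaceMapComplex F)

@[simp]
lemma mapAlternatingFaceMapComplexIso_hom_app_f (F : V ⥤ W) [F.Additive] (X : SimplicialObject V)
    (n : ℕ) : ((mapAlternatingFaceMapComplexIso F).hom.app X).f n = 𝟙 _ :=
  (congrArg (HomologicalComplex.Hom.f · n) (eqToHom_app (map_alternatingFaceMapComplex F) X)).trans
    ((HomologicalComplex.eqToHom_f _ n).trans rfl)

/-- Naturality in the functor rather than in the simplicial object; it yields naturality of the
`Tor` comparison in `N`. It holds because the comparison is the identity in each degree. -/
lemma mapAlternatingFaceMapComplexIso_hom_app_natural {F G : V ⥤ W} [F.Additive] [G.Additive]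
    (α : F ⟶ G) (X : SimplicialObject V) :
    (NatTrans.mapHomologicalComplex α _).app ((alternatingFaceMapComplex V).obj X) ≫
        (mapAlternatingFaceMapComplexIso G).hom.app X =
      (mapAlternatingFaceMapComplexIso F).hom.app X ≫
        (alternatingFaceMapComplex W).map (Functor.whiskerLeft X α) := by
  refine HomologicalComplex.hom_ext _ _ fun n => ?_
  refine (HomologicalComplex.comp_f _ _ _).trans (Eq.trans ?_ (HomologicalComplex.comp_f _ _ _).symm)
  rw [mapAlternatingFaceMapComplexIso_hom_app_f, mapAlternatingFaceMapComplexIso_hom_app_f]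
  exact (Category.comp_id _).trans (Category.id_comp _).symm

lemma quasiIso_map_augmentation [Limits.HasZeroObject V] [Limits.HasZeroObject W]
    [CategoryWithHomology W] (F : V ⥤ W) [F.Additive] (X : SimplicialObject.Augmented V)
    (h : QuasiIso (AlternatingFaceMapComplex.ε.app
      (((SimplicialObject.Augmented.whiskering V W).obj F).obj X))) :
    QuasiIso ((F.mapHomologicalComplex _).map (AlternatingFaceMapComplex.ε.app X)) := by
  let a := (mapAlternatingFaceMapComplexIso F).hom.app X.left
  let b : (F.mapHomologicalComplex _).obj ((ChainComplex.single₀ V).obj X.right) ⟶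
      (ChainComplex.single₀ W).obj (F.obj X.right) :=
    (HomologicalComplex.singleMapHomologicalComplex F _ 0).hom.app X.right
  let f : (F.mapHomologicalComplex _).obj ((alternatingFaceMapComplex V).obj X.left) ⟶
      (F.mapHomologicalComplex _).obj ((ChainComplex.single₀ V).obj X.right) :=
    (F.mapHomologicalComplex _).map (AlternatingFaceMapComplex.ε.app X)
  let g : (alternatingFaceMapComplex W).obj (((SimplicialObject.whiskering V W).obj F).obj X.left) ⟶
      (ChainComplex.single₀ W).obj (F.obj X.right) :=
    AlternatingFaceMapComplex.ε.app (((SimplicialObject.Augmented.whiskering V W).obj F).obj X)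
  have hg : QuasiIso g := h
  have e : f ≫ b = a ≫ g := by
    -- The target is concentrated in degree `0`, where both comparison maps are identities.
    refine HomologicalComplex.to_single_hom_ext ?_
    rw [HomologicalComplex.comp_f, HomologicalComplex.comp_f]
    have h1 : g.f 0 = F.map (X.hom.app _) :=
      (AlternatingFaceMapComplex.ε_app_f_zero
        (((SimplicialObject.Augmented.whiskering V W).obj F).obj X)).trans
        (Category.comp_id _)
    have h2 : f.f 0 = F.map (X.hom.app _) :=
      congrArg F.map (AlternatingFaceMapComplex.ε_app_f_zero _)
    have h3 : b.f 0 = 𝟙 (F.obj X.right) := by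
      refine (HomologicalComplex.singleMapHomologicalComplex_hom_app_self F _ 0 X.right).trans ?_
      rw [ChainComplex.single₀ObjXSelf, ChainComplex.single₀ObjXSelf]
      exact (Category.comp_id _).trans (F.map_id _)
    rw [h1, h2, h3, mapAlternatingFaceMapComplexIso_hom_app_f]
    exact (Category.comp_id _).trans (Category.id_comp _).symm
  have : QuasiIso (f ≫ b) := by
    rw [e]
    exact quasiIso_comp a g
  exact quasiIso_of_comp_right f b

end AlternatingFaceMapComplex

/-! ### Functors to categories of objects under `X` -/

section Under

variable {C E : Type} [SmallCategory C] [SmallCategory E]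

/-- A functor to `Under X` is definitionally the lift of its underlying functor and cone. Functors
with the same underlying functor are therefore compared on structure arrows alone. -/
lemma underLift_congr {X : C} {K : E ⥤ C} {s t : (Functor.const E).obj X ⟶ K}
    (h : ∀ U, s.app U = t.app U) : Under.lift K s = Under.lift K t :=
  congrArg (Under.lift K) (NatTrans.ext (funext h))

/-- A functor to a category of objects under `X` as a functor with a cone. -/
abbrev underCone {X : C} (S : E ⥤ Under X) : (Functor.const E).obj X ⟶ S ⋙ Under.forget X where
  app U := (S.obj U).hom

end Under

/-! ### The standard projective resolution of the trivial module -/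

section Resolution

variable (k : Type u) [CommRing k] (C : Type) [SmallCategory C]

variable {C} in
/-- The string of arrows under its first object that is given by a string of arrows. -/
def underLeft {n : ℕ} (c : ComposableArrows C n) : ComposableArrows (Under c.left) n where
  obj i := Under.mk (c.map (homOfLE (Fin.zero_le i)))
  map f := Under.homMk (c.map f) (c.map_comp _ f).symm
  map_id i := by
    ext
    exact c.map_id i
  map_comp f g := by
    ext
    exact c.map_comp f g

variable {C} in
-- The Yoneda-type fact behind projectivity: each structure arrow `X → cᵢ` factors as `X → c₀ → cᵢ`,
-- so every simplex is pulled back from the universal simplex on its string along `X → c₀`.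
lemma underLeft_comp_map {n : ℕ} {X : C} (σ : ComposableArrows (Under X) n) :
    (underLeft (σ ⋙ Under.forget X) ⋙ Under.map σ.left.hom : ComposableArrows _ n) = σ := by
  exact underLift_congr (K := σ ⋙ Under.forget X)
    (s := underCone (underLeft (σ ⋙ Under.forget X) ⋙ Under.map σ.left.hom))
    (t := underCone σ) fun i => Under.w (σ.map (homOfLE (Fin.zero_le i)))

/-- The module is freely generated by the universal simplices `underLeft c`, so a lift amounts to an
arbitrary choice of preimage for each of them. -/
instance projective_underNerveModule_obj (Δ : SimplexCategoryᵒᵖ) :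
    Projective ((underNerveModule k C).obj Δ) where
  factors {E B} f e _ := by
    have hsurj : ∀ c : ComposableArrows C Δ.unop.len, ∃ x : E.obj (op c.left),
        e.app (op c.left) x = f.app (op c.left) (basisSimplex k (X := op c.left) (underLeft c)) := fun c =>
      (ModuleCat.epi_iff_surjective _).mp ((NatTrans.epi_iff_epi_app e).mp ‹_› (op c.left)) _
    choose x hx using hsurj
    let u : ∀ (X : Cᵒᵖ) (σ : ComposableArrows (Under X.unop) Δ.unop.len),
        op (ComposableArrows.left (σ ⋙ Under.forget X.unop)) ⟶ X := fun X σ => op σ.left.hom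
    let lift : ∀ X : Cᵒᵖ, ((underNerveModule k C).obj Δ).obj X →ₗ[k] E.obj X :=
      fun X => basisLift fun σ => E.map (u X σ) (x (σ ⋙ Under.forget X.unop))
    refine ⟨{ app := fun X => ModuleCat.ofHom (lift X), naturality := fun X Y g => ?_ }, ?_⟩
    · ext1
      refine basis_ext fun σ => ?_
      change lift Y (((underNerveModule k C).obj Δ).map g (basisSimplex k σ)) =
        E.map g (lift X (basisSimplex k σ))
      rw [underNerveModule_obj_map_basisSimplex, basisLift_basisSimplex, basisLift_basisSimplex]
      -- Restriction along `g` keeps the string in `C`, hence the chosen `x`, and only changes the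
      -- arrow to `c₀`.
      exact Functor.map_comp_apply E (u X σ) g _
    · ext X : 3
      refine basis_ext fun σ => ?_
      change e.app X (lift X (basisSimplex k σ)) = f.app X (basisSimplex k σ)
      rw [basisLift_basisSimplex, NatTrans.naturality_apply, hx, ← NatTrans.naturality_apply,
        underNerveModule_obj_map_basisSimplex]
      exact congrArg (fun τ => f.app X (basisSimplex k τ)) (underLeft_comp_map σ)

/-- The extra degeneracies are not natural in `X`, but quasi-isomorphisms are detected objectwise.
-/
instance quasiIso_augmentation :
    QuasiIso (AlgebraicTopology.AlternatingFaceMapComplex.ε.app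
      (augmentedUnderNerveModule k C)) := by
  refine (HomologicalComplex.quasiIso_iff_evaluation _).mpr fun X => ?_
  exact quasiIso_map_augmentation _ _ (extraDegeneracy k X).homotopyEquiv.quasiIso_hom

/-- The projective resolution of the trivial `Cᵒᵖ`-module by the modules `k[N_n(- \ C)]`. -/
def standardResolution : ProjectiveResolution (trivialModule k C) where
  complex := (AlgebraicTopology.alternatingFaceMapComplex _).obj (underNerveModule k C)
  projective _ := inferInstanceAs (Projective ((underNerveModule k C).obj _))
  π := AlgebraicTopology.AlternatingFaceMapComplex.ε.app (augmentedUnderNerveModule k C)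
  quasiIso := quasiIso_augmentation k C

end Resolution

/-! ### `Tor` as the homology of the standard complex -/

section TorComparison

variable (k : Type u) [CommRing k] (C : Type) [SmallCategory C]

/-- Pastes the naturality of `isoLeftDerivedObj`, given as a conjugation, with that of
`mapAlternatingFaceMapComplexIso`. -/
lemma comp_hom_comp_eq {V : Type*} [Category V] {X X' Y Y' Z Z' : V} {l : X ⟶ X'} {p : X ≅ Y}
    {p' : X' ≅ Y'} {t : Y ⟶ Y'} {b : Y ⟶ Z} {b' : Y' ⟶ Z'} {s : Z ⟶ Z'}
    (h : l = p.hom ≫ t ≫ p'.inv) (h' : t ≫ b' = b ≫ s) :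
    l ≫ p'.hom ≫ b' = (p.hom ≫ b) ≫ s := by
  simp [h, h']

/-- `Tor_n^C(k, N)` is the homology of the complex `k[N(- \ C)] ⊗_C N`, naturally in `N`. -/
def torIsoHomology (n : ℕ) : tor k C n (trivialModule k C) ≅
    standardComplex k C ⋙
      HomologicalComplex.homologyFunctor (ModuleCat.{u} k) (ComplexShape.down ℕ) n :=
  NatIso.ofComponents (fun N =>
    (standardResolution k C).isoLeftDerivedObj ((tensorFunctor k C).obj N) n ≪≫
      (HomologicalComplex.homologyFunctor _ _ n).mapIso
        ((mapAlternatingFaceMapComplexIso ((tensorFunctor k C).obj N)).app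
          (underNerveModule k C)))
    (fun {N N'} τ => by
      -- The resolution does not depend on `N`, so the map induced by `τ` is computed on it
      -- directly.
      refine comp_hom_comp_eq ((standardResolution k C).leftDerived_app_eq _ n) ?_
      refine ((HomologicalComplex.homologyFunctor _ _ n).map_comp _ _).symm.trans (Eq.trans ?_
        ((HomologicalComplex.homologyFunctor _ _ n).map_comp _ _))
      exact congrArg (HomologicalComplex.homologyFunctor _ _ n).map
        (mapAlternatingFaceMapComplexIso_hom_app_natural ((tensorFunctor k C).map τ)
          (underNerveModule k C)))

end TorComparison

/-! ### Translations along `η : 𝟭 ⟶ G` and homotopy invariance of the standard complex -/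

section Translation

variable {k : Type u} [CommRing k] {C D : Type} [SmallCategory C] [SmallCategory D]

/-- The element `σ ⊗ x` of `k[N_n(- \ C)] ⊗_C N`, for a simplex `σ` of `N(X \ C)` and `x` in
`N(X)`. -/
def simplexTensor (N : C ⥤ ModuleCat.{u} k) {Δ : SimplexCategoryᵒᵖ} {X : C}
    (σ : ComposableArrows (Under X) Δ.unop.len) (x : N.obj X) :
    ((simplicialTensor k C).obj N).obj Δ :=
  CTensor.incl ((underNerveModule k C).obj Δ) N X (basisSimplex k (X := op X) σ ⊗ₜ x)

/-- The relation of the tensor product on generators; it moves the components of `η` from the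
coefficients to the simplices. -/
lemma simplexTensor_map (N : C ⥤ ModuleCat.{u} k) {Δ : SimplexCategoryᵒᵖ} {X Y : C} (f : X ⟶ Y)
    (σ : ComposableArrows (Under Y) Δ.unop.len) (x : N.obj X) :
    simplexTensor N σ (N.map f x) = simplexTensor N (σ ⋙ Under.map f) x :=
  (CTensor.incl_rel f _ x).trans (congrArg
    (fun y => CTensor.incl ((underNerveModule k C).obj Δ) N X (y ⊗ₜ x))
    (underNerveModule_obj_map_basisSimplex k C f.op σ))

lemma simplicialTensor_hom_ext {N : C ⥤ ModuleCat.{u} k} {M : SimplicialObject (ModuleCat.{u} k)}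
    {f g : (simplicialTensor k C).obj N ⟶ M}
    (h : ∀ (Δ : SimplexCategoryᵒᵖ) (X : C)
      (σ : ComposableArrows (Under X) Δ.unop.len) (x : N.obj X),
      f.app Δ (simplexTensor N σ x) = g.app Δ (simplexTensor N σ x)) : f = g := by
  apply NatTrans.ext
  funext Δ
  ext1
  refine CTensor.hom_ext fun X y x => ?_
  let a : ((underNerveModule k C).obj Δ).obj (op X) →ₗ[k]
      CTensor ((underNerveModule k C).obj Δ) N :=
    CTensor.incl ((underNerveModule k C).obj Δ) N X ∘ₗ (TensorProduct.mk k _ _).flip x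
  have e : (f.app Δ).hom ∘ₗ a = (g.app Δ).hom ∘ₗ a := basis_ext fun σ => h Δ X σ x
  exact LinearMap.congr_fun e y

lemma tensor_map_simplexTensor (N : C ⥤ ModuleCat.{u} k) {Δ : SimplexCategoryᵒᵖ}
    {M : Cᵒᵖ ⥤ ModuleCat.{u} k} (φ : (underNerveModule k C).obj Δ ⟶ M) {X : C}
    (σ : ComposableArrows (Under X) Δ.unop.len) (x : N.obj X) :
    CTensor.map φ (𝟙 N) (simplexTensor N σ x) =
      CTensor.incl M N X (φ.app (op X) (basisSimplex k (X := op X) σ) ⊗ₜ x) :=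
  CTensor.map_incl φ (𝟙 N) X (basisSimplex k (X := op X) σ) x

lemma simplicialTensor_map_app_simplexTensor {N N' : C ⥤ ModuleCat.{u} k} (τ : N ⟶ N')
    {Δ : SimplexCategoryᵒᵖ} {X : C} (σ : ComposableArrows (Under X) Δ.unop.len) (x : N.obj X) :
    ((simplicialTensor k C).map τ).app Δ (simplexTensor N σ x) = simplexTensor N' σ (τ.app X x) :=
  CTensor.map_incl (𝟙 ((underNerveModule k C).obj Δ)) τ X (basisSimplex k (X := op X) σ) x

lemma underNerveModuleMap_app_app_basisSimplex (i : C ⥤ D) {Δ : SimplexCategoryᵒᵖ} {X : C}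
    (σ : ComposableArrows (Under X) Δ.unop.len) :
    ((underNerveModuleMap k i).app Δ).app (op X) (basisSimplex k (X := op X) σ) =
      basisSimplex k (X := op (i.obj X)) (σ ⋙ Under.post i) :=
  Finsupp.mapDomain_single

lemma simplicialTensorMap_app_app_simplexTensor (i : C ⥤ D) (N : D ⥤ ModuleCat.{u} k)
    {Δ : SimplexCategoryᵒᵖ} {X : C} (σ : ComposableArrows (Under X) Δ.unop.len)
    (x : N.obj (i.obj X)) :
    ((simplicialTensorMap k i).app N).app Δ (simplexTensor (i ⋙ N) σ x) =
      simplexTensor N (σ ⋙ Under.post i) x :=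
  (congrArg (CTensor.change i ((underNerveModule k D).obj Δ) N)
    (tensor_map_simplexTensor (i ⋙ N) ((underNerveModuleMap k i).app Δ) σ x)).trans
    ((CTensor.change_incl i _ N X _).trans (congrArg
      (fun y => CTensor.incl ((underNerveModule k D).obj Δ) N (i.obj X) (y ⊗ₜ x))
      (underNerveModuleMap_app_app_basisSimplex i σ)))

/-- For `η : 𝟭 ⟶ G`, the functor sending `X ⟶ Y` to `X ⟶ Y ⟶ G Y`. -/
def underTranslate {G : C ⥤ C} (η : 𝟭 C ⟶ G) (X : C) : Under X ⥤ Under X :=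
  Under.lift (Under.forget X ⋙ G)
    { app := fun U => U.hom ≫ η.app U.right
      naturality := fun U V f => by
        have h := η.naturality f.right
        have hw := Under.w f
        change 𝟙 X ≫ V.hom ≫ η.app V.right = (U.hom ≫ η.app U.right) ≫ G.map f.right
        rw [Category.id_comp, Category.assoc, ← h, ← hw, Category.assoc]
        rfl }

lemma map_comp_underTranslate {G : C ⥤ C} (η : 𝟭 C ⟶ G) {X Y : C} (f : X ⟶ Y) :
    Under.map f ⋙ underTranslate η X = underTranslate η Y ⋙ Under.map f :=
  underLift_congr (K := Under.forget Y ⋙ G)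
    (s := underCone (Under.map f ⋙ underTranslate η X))
    (t := underCone (underTranslate η Y ⋙ Under.map f)) fun _ => Category.assoc _ _ _

/-- For `η : 𝟭 ⟶ G`, the endomorphism of `k[N(- \ C)]` induced by the functors sending `X ⟶ Y` to
`X ⟶ Y ⟶ G Y`. -/
def translate {G : C ⥤ C} (η : 𝟭 C ⟶ G) : underNerveModule k C ⟶ underNerveModule k C where
  app Δ :=
    { app := fun X => ModuleCat.ofHom (basisLift fun σ =>
        basisSimplex k (σ ⋙ underTranslate η X.unop))
      naturality := fun X Y f => by
        ext1
        refine basis_ext fun σ => ?_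
        change basisLift (fun σ => basisSimplex k (σ ⋙ underTranslate η Y.unop))
            (((underNerveModule k C).obj Δ).map f (basisSimplex k σ)) =
          ((underNerveModule k C).obj Δ).map f
            (basisLift (fun σ => basisSimplex k (σ ⋙ underTranslate η X.unop)) (basisSimplex k σ))
        rw [underNerveModule_obj_map_basisSimplex, basisLift_basisSimplex, basisLift_basisSimplex,
          underNerveModule_obj_map_basisSimplex]
        exact congrArg (fun T => basisSimplex k (σ ⋙ T)) (map_comp_underTranslate η f.unop) }
  naturality Δ Δ' δ := by
    ext X : 3
    refine basis_ext fun σ => ?_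
    change basisLift (fun σ => basisSimplex k (σ ⋙ underTranslate η X.unop))
        (((underNerveModule k C).map δ).app X (basisSimplex k σ)) =
      ((underNerveModule k C).map δ).app X
        (basisLift (fun σ => basisSimplex k (σ ⋙ underTranslate η X.unop)) (basisSimplex k σ))
    rw [underNerveModule_map_app_basisSimplex, basisLift_basisSimplex, basisLift_basisSimplex,
      underNerveModule_map_app_basisSimplex]
    rfl

@[simp]
lemma translate_app_app_basisSimplex {G : C ⥤ C} (η : 𝟭 C ⟶ G) (Δ : SimplexCategoryᵒᵖ) (X : Cᵒᵖ)
    (σ : ComposableArrows (Under X.unop) Δ.unop.len) :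
    ((translate η).app Δ).app X (basisSimplex k σ) =
      basisSimplex k (σ ⋙ underTranslate η X.unop) :=
  basisLift_basisSimplex _ _

lemma whiskerRight_translate_app_simplexTensor {G : C ⥤ C} (η : 𝟭 C ⟶ G)
    (N : C ⥤ ModuleCat.{u} k) {Δ : SimplexCategoryᵒᵖ} {X : C}
    (σ : ComposableArrows (Under X) Δ.unop.len) (x : N.obj X) :
    (Functor.whiskerRight (translate η) ((tensorFunctor k C).obj N)).app Δ
      (simplexTensor N σ x) = simplexTensor N (σ ⋙ underTranslate η X) x :=
  (tensor_map_simplexTensor N ((translate η).app Δ) σ x).trans (congrArg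
    (fun y => CTensor.incl ((underNerveModule k C).obj Δ) N X (y ⊗ₜ x))
    (translate_app_app_basisSimplex η Δ (op X) σ))

/-- The translation along `η : 𝟭 ⟶ G` is homotopic to the identity, as it is an endomorphism of a
projective resolution over the identity. -/
def translateHomotopy {G : C ⥤ C} (η : 𝟭 C ⟶ G) :
    Homotopy ((AlgebraicTopology.alternatingFaceMapComplex _).map (translate (k := k) η)) (𝟙 _) :=
  ProjectiveResolution.liftHomotopy (P := standardResolution k C) (Q := standardResolution k C)
    (𝟙 _) _ _ (by
      refine HomologicalComplex.to_single_hom_ext ?_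
      have h : (standardResolution k C).π.f 0 =
          (augmentedUnderNerveModule k C).hom.app (op (SimplexCategory.mk 0)) :=
        AlgebraicTopology.AlternatingFaceMapComplex.ε_app_f_zero _
      refine (HomologicalComplex.comp_f _ _ _).trans
        (Eq.trans ?_ (HomologicalComplex.comp_f _ _ _).symm)
      rw [h]
      refine Eq.trans ?_ (Category.comp_id _).symm
      -- Every vertex has augmentation `1`, before and after translation.
      ext X : 3
      refine basis_ext fun σ => ?_
      exact (congrArg (basisLift (M := k) fun _ => 1)
          (translate_app_app_basisSimplex η _ X σ)).trans
          ((basisLift_basisSimplex (M := k) _ _).trans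
            (basisLift_basisSimplex (M := k) (fun _ => 1) σ).symm)) (by
      rw [CategoryTheory.Functor.map_id, Category.comp_id]
      exact Category.id_comp _)

/-- The tensor product with `N` of the translation along `η : 𝟭 ⟶ G` is homotopic to the
identity. -/
def tensorTranslateHomotopy {G : C ⥤ C} (η : 𝟭 C ⟶ G) (N : C ⥤ ModuleCat.{u} k) :
    Homotopy ((AlgebraicTopology.alternatingFaceMapComplex _).map
      (Functor.whiskerRight (translate η) ((tensorFunctor k C).obj N)))
      (𝟙 ((standardComplex k C).obj N)) := by
  let T := (tensorFunctor k C).obj N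
  let e := (mapAlternatingFaceMapComplexIso T).app (underNerveModule k C)
  let Φ := T.mapHomologicalComplex (ComplexShape.down ℕ)
  -- An additive functor preserves homotopies; `e` transports the result to the complex of the
  -- tensored simplicial module.
  refine (Homotopy.ofEq ?_).trans ((((Functor.mapHomotopy T (translateHomotopy (k := k) η)).compRight
    e.hom).compLeft e.inv).trans (Homotopy.ofEq ?_))
  · exact (Iso.eq_inv_comp e).mpr
      ((mapAlternatingFaceMapComplexIso T).hom.naturality (translate η)).symm
  · exact (congrArg (fun f => e.inv ≫ f ≫ e.hom) (Φ.map_id _)).trans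
      ((congrArg (e.inv ≫ ·) (Category.id_comp e.hom)).trans e.inv_hom_id)

variable {i : C ⥤ D} {F : D ⥤ C} (η : 𝟭 D ⟶ F ⋙ i)

/-- The map `k[N(- \ D)] ⊗_D N ⟶ k[N(- \ C)] ⊗_C N` induced by a functor `F : D ⥤ C` and a natural
transformation `𝟭 ⟶ F ⋙ i`. -/
def simplicialTensorRetraction (N : D ⥤ ModuleCat.{u} k) :
    (simplicialTensor k D).obj N ⟶ (simplicialTensor k C).obj (i ⋙ N) :=
  (simplicialTensor k D).map (Functor.whiskerRight η N) ≫ (simplicialTensorMap k F).app (i ⋙ N)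

lemma simplicialTensorRetraction_app_simplexTensor (N : D ⥤ ModuleCat.{u} k)
    {Δ : SimplexCategoryᵒᵖ} {X : D} (σ : ComposableArrows (Under X) Δ.unop.len) (x : N.obj X) :
    (simplicialTensorRetraction η N).app Δ (simplexTensor N σ x) =
      simplexTensor (i ⋙ N) (σ ⋙ Under.post F) (N.map (η.app X) x) :=
  (congrArg (((simplicialTensorMap k F).app (i ⋙ N)).app Δ)
    (simplicialTensor_map_app_simplexTensor (Functor.whiskerRight η N) σ x)).trans
    (simplicialTensorMap_app_app_simplexTensor F (i ⋙ N) σ _)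

/-- This is naturality of `η` at the structure arrow: `X → iFX → iFY` equals `X → Y → iFY`. -/
lemma post_comp_map_eq_underTranslate (X : D) :
    (Under.post F ⋙ Under.post i) ⋙ Under.map (η.app X) = underTranslate η X :=
  underLift_congr (K := Under.forget X ⋙ F ⋙ i)
    (s := underCone ((Under.post F ⋙ Under.post i) ⋙ Under.map (η.app X)))
    (t := underCone (underTranslate η X)) fun U => (η.naturality U.hom).symm

lemma simplicialTensorRetraction_comp_simplicialTensorMap (N : D ⥤ ModuleCat.{u} k) :
    simplicialTensorRetraction η N ≫ (simplicialTensorMap k i).app N =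
      Functor.whiskerRight (translate η) ((tensorFunctor k D).obj N) :=
  simplicialTensor_hom_ext fun Δ X σ x =>
    ((congrArg (((simplicialTensorMap k i).app N).app Δ)
      (simplicialTensorRetraction_app_simplexTensor η N σ x)).trans
    (simplicialTensorMap_app_app_simplexTensor i N _ _)).trans
    ((simplexTensor_map N (η.app X) _ x).trans
    ((congrArg (fun T => simplexTensor N (σ ⋙ T) x) (post_comp_map_eq_underTranslate η X)).trans
    (whiskerRight_translate_app_simplexTensor η N σ x).symm))

/-- Here the tensor product is over `C`, so `η` at `i X` can cross the tensor sign only as the image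
of an arrow of `C`; `h` supplies that arrow, `θ.app X`. -/
lemma simplicialTensorMap_comp_simplicialTensorRetraction (θ : 𝟭 C ⟶ i ⋙ F)
    (h : ∀ X, i.map (θ.app X) = η.app (i.obj X)) (N : D ⥤ ModuleCat.{u} k) :
    (simplicialTensorMap k i).app N ≫ simplicialTensorRetraction η N =
      Functor.whiskerRight (translate θ) ((tensorFunctor k C).obj (i ⋙ N)) :=
  simplicialTensor_hom_ext fun Δ X σ x =>
    ((congrArg ((simplicialTensorRetraction η N).app Δ)
      (simplicialTensorMap_app_app_simplexTensor i N σ x)).trans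
    (simplicialTensorRetraction_app_simplexTensor η N _ x)).trans
    ((congrArg (fun f => simplexTensor (i ⋙ N) _ (N.map f x)) (h X).symm).trans
    ((simplexTensor_map (i ⋙ N) (θ.app X) _ x).trans
    ((congrArg (fun T => simplexTensor (i ⋙ N) (σ ⋙ T) x)
      (post_comp_map_eq_underTranslate θ X)).trans
    (whiskerRight_translate_app_simplexTensor θ (i ⋙ N) σ x).symm)))

/-- If `i : C ⥤ D` has a homotopy inverse `F` with natural transformations `𝟭 ⟶ F ⋙ i` and
`𝟭 ⟶ i ⋙ F` that agree on `C`, then `k[N(- \ C)] ⊗_C N ⟶ k[N(- \ D)] ⊗_D N` is a homotopy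
equivalence. -/
def standardComplexHomotopyEquiv (θ : 𝟭 C ⟶ i ⋙ F) (h : ∀ X, i.map (θ.app X) = η.app (i.obj X))
    (N : D ⥤ ModuleCat.{u} k) :
    HomotopyEquiv ((standardComplex k C).obj (i ⋙ N)) ((standardComplex k D).obj N) where
  hom := (AlgebraicTopology.alternatingFaceMapComplex _).map ((simplicialTensorMap k i).app N)
  inv := (AlgebraicTopology.alternatingFaceMapComplex _).map (simplicialTensorRetraction η N)
  homotopyHomInvId := (Homotopy.ofEq (by
    exact ((AlgebraicTopology.alternatingFaceMapComplex _).map_comp _ _).symm.trans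
      (congrArg _ (simplicialTensorMap_comp_simplicialTensorRetraction η θ h N)))).trans
      (tensorTranslateHomotopy θ (i ⋙ N))
  homotopyInvHomId := (Homotopy.ofEq (by
    exact ((AlgebraicTopology.alternatingFaceMapComplex _).map_comp _ _).symm.trans
      (congrArg _ (simplicialTensorRetraction_comp_simplicialTensorMap η N)))).trans
      (tensorTranslateHomotopy η N)

end Translation

/-! ### Adjoining a point to the objects of `ΔS₊` -/

section Shift

namespace DeltaSPlus

/-- The endofunctor `[n] ↦ [0] ⊔ [n]` of `ΔS₊`. -/
def shift : DeltaSPlus ⥤ DeltaSPlus where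
  obj X := ⟨X.card + 1⟩
  map {X Y} f :=
    -- The new variable alone lies over the new point; the old words are reindexed by `Fin.succ`.
    { word := Fin.cases [0] fun j => (Hom.word f j).map Fin.succ
      count_eq_one := fun i => by
        rw [Fin.sum_univ_succ]
        refine Fin.cases ?_ (fun i => ?_) i
        · have h : ∀ j, (List.map Fin.succ (Hom.word f j)).count 0 = 0 := fun j =>
            List.count_eq_zero.mpr (by simp)
          simp [h]
        · have h : ∀ j, (List.map Fin.succ (Hom.word f j)).count i.succ = (Hom.word f j).count i :=
            fun j => List.count_map_of_injective _ _ (Fin.succ_injective _) i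
          simp [h, Hom.count_eq_one f i, (Fin.succ_ne_zero i).symm] }
  map_id X := by
    refine Hom.ext (funext fun j => ?_)
    refine Fin.cases rfl (fun j => ?_) j
    rfl
  map_comp f g := by
    refine Hom.ext (funext fun j => ?_)
    refine Fin.cases rfl (fun j => ?_) j
    simp [comp_word, List.flatMap_map, List.map_flatMap]

/-- The inclusions `[n] ⟶ [0] ⊔ [n]`. -/
def toShift : 𝟭 DeltaSPlus ⟶ shift where
  app X :=
    -- The fibre over the new point is empty, so on tensors a factor `1` is inserted in front.
    { word := Fin.cases [] fun j => [j]
      count_eq_one := fun i => by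
        refine (Fin.sum_univ_succ (n := X.card) _).trans ?_
        simp [List.count_singleton] }
  naturality X Y f := by
    refine Hom.ext (funext fun j => ?_)
    refine Fin.cases rfl (fun j => ?_) j
    simp [comp_word, shift, List.flatMap_map]

/-- The functor `[n] ↦ [0] ⊔ [n]` from `ΔS₊` to `ΔS`. -/
def shiftNonempty : DeltaSPlus ⥤ DeltaS :=
  ObjectProperty.lift _ shift fun X => X.card.succ_pos

/-- The inclusions `[n] ⟶ [0] ⊔ [n]` for `n ≥ 0`. -/
def toShiftNonempty : 𝟭 DeltaS ⟶ inclusion ⋙ shiftNonempty where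
  app X := ObjectProperty.homMk (toShift.app X.obj)
  naturality X Y f := by
    ext1
    exact toShift.naturality f.hom

end DeltaSPlus

end Shift

end

end SymmetricHomology

/-! ### The main theorem -/

theorem mainTheorem1 (k : Type u) [CommRing k] :
    (∀ n : ℕ, Nonempty (SymmetricHomology.HS k n ≅ SymmetricHomology.YPlusComplex k ⋙
      HomologicalComplex.homologyFunctor (ModuleCat.{u} k) (ComplexShape.down ℕ) n)) ∧
    ∀ A : AlgCat.{u} k, QuasiIso ((SymmetricHomology.J k).app A) := by
  have hJ : ∀ A : AlgCat.{u} k, QuasiIso ((SymmetricHomology.J k).app A) := fun A =>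
    -- The two inclusions agree on `ΔS` by definition, and `J` at `A` is the underlying map of this
    -- homotopy equivalence.
    (SymmetricHomology.standardComplexHomotopyEquiv (i := SymmetricHomology.inclusion)
      (F := SymmetricHomology.DeltaSPlus.shiftNonempty) SymmetricHomology.DeltaSPlus.toShift
      SymmetricHomology.DeltaSPlus.toShiftNonempty (fun _ => rfl)
      ((SymmetricHomology.barPlus k).obj A)).quasiIso_hom
  refine ⟨fun n => ?_, hJ⟩
  let H := HomologicalComplex.homologyFunctor (ModuleCat.{u} k) (ComplexShape.down ℕ) n
  -- Since `J` is natural in `A`, its objectwise isomorphisms on homology form a natural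
  -- isomorphism.
  let j := Functor.whiskerRight (SymmetricHomology.J k) H
  have hj : ∀ A, IsIso (j.app A) := fun A =>
    inferInstanceAs (IsIso (HomologicalComplex.homologyMap ((SymmetricHomology.J k).app A) n))
  have hj' : IsIso j := NatIso.isIso_of_isIso_app j
  let e := asIso j
  exact ⟨Functor.isoWhiskerLeft (SymmetricHomology.bar k)
    (SymmetricHomology.torIsoHomology k SymmetricHomology.DeltaS n) ≪≫ e⟩
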